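/- For an integer $q\ge 2$ and an infinite word $w\in\{0,\dots,q-1\}^{\mathbb N}$, let $p_w(n)$ be the number of distinct factors of length $n$ of $w$, and let $E(w)=\lim_{n\to\infty}\frac1n\log p_w(n)$ (this limit exists). For $f:\mathbb N\to(0,\infty)$ put $E_0(f)=\liminf_{n\to\infty}\frac1n\log f(n)$ and $$E_W(f)=\sup\{E(w): w\in\{0,\dots,q-1\}^{\mathbb N},\ p_w(n)\le f(n)\ \text{for all } n\in\mathbb N\},$$ the word entropy of $f$ over the alphabet with $q$ letters. Say that $f$ satisfies the conditions $(\mathcal C^*)$ if $f(n+1)>f(n)\ge n+1$ for all $n\in\mathbb N$ and $f(n+n')\le f(n)f(n')$ for all $n,n'\in\mathbb N$ (where $0\in\mathbb N$). Say that $f$ has exponential order $h$ if there are constants $c_1,c_2>0$ with $c_1e^{hn}\le f(n)\le c_2e^{hn}$ for all $n\in\mathbb N$. There is a non-increasing function $C:(0,\infty)\to[1,\infty)$ such that for every real $h>0$ the following hold. 1. For every integer $q\ge\lceil e^h\rceil$ there is an infinite word $w$ over $\{0,\dots,q-1\}$ with $e^{hn}\le p_w(n)\le C(h)e^{hn}$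 for all $n\in\mathbb N$. 2. The function $f(n)=\max\{n+1,\,C(h)e^{hn}\}$ satisfies the conditions $(\mathcal C^*)$, has exponential order $h$, satisfies $E_0(f)=h$, and satisfies $E_W(f)=h$ over every alphabet with $q\ge\lceil e^h\rceil$ letters. -/

import Mathlib

open Filter Topology

namespace WordComplexity

/-- The set `L_n(w)` of factors of length `n` of the infinite word `w`. -/
def factors {A : Type*} (w : ℕ → A) (n : ℕ) : Set (Fin n → A) :=
  {v | ∃ k : ℕ, ∀ i : Fin n, v i = w (k + i)}

/-- The complexity function `p_w(n) = |L_n(w)|`. -/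
noncomputable def complexity {A : Type*} (w : ℕ → A) (n : ℕ) : ℕ :=
  (factors w n).ncard

/-- `E(w) = lim (1/n) log p_w(n)`; over a finite alphabet the limit exists, see
`tendsto_entropy`. -/
noncomputable def entropy {A : Type*} (w : ℕ → A) : ℝ :=
  limUnder atTop (fun n : ℕ => (1 / (n : ℝ)) * Real.log (complexity w n))

/-- `W(f)`: the infinite words over `A = Fin q` whose complexity is bounded by `f`. -/
def boundedWords (q : ℕ) (f : ℕ → ℝ) : Set (ℕ → Fin q) :=
  {w | ∀ n : ℕ, (complexity w n : ℝ) ≤ f n}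

/-- The word entropy `E_W(f) = sup {E(w) | w ∈ W(f)}`, as an extended real number. -/
noncomputable def wordEntropy (q : ℕ) (f : ℕ → ℝ) : EReal :=
  ⨆ w ∈ boundedWords q f, ((entropy w : ℝ) : EReal)

/-- The lower exponential growth rate `E_0(f) = liminf (1/n) log f(n)`, as an extended real
number, for positive `f`. -/
noncomputable def lowerGrowth (f : ℕ → ℝ) : EReal :=
  liminf (fun n : ℕ => (((1 / (n : ℝ)) * Real.log (f n) : ℝ) : EReal)) atTop

/-- The conditions `(C*)`. -/
def ConditionsCStar (f : ℕ → ℝ) : Prop :=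
  (∀ n : ℕ, f n < f (n + 1) ∧ (n : ℝ) + 1 ≤ f n) ∧
    ∀ n n' : ℕ, f (n + n') ≤ f n * f n'

/-- `f` has (exact) exponential order `h`. -/
def HasExponentialOrder (f : ℕ → ℝ) (h : ℝ) : Prop :=
  ∃ c₁ c₂ : ℝ, 0 < c₁ ∧ 0 < c₂ ∧
    ∀ n : ℕ, c₁ * Real.exp (h * n) ≤ f n ∧ f n ≤ c₂ * Real.exp (h * n)

/-- The function `n ↦ max {n + 1, c e^{hn}}`. -/
noncomputable def maxLinearExp (c h : ℝ) : ℕ → ℝ :=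
  fun n => max ((n : ℝ) + 1) (c * Real.exp (h * n))

theorem complexity_pos {A : Type*} [Finite A] (w : ℕ → A) (n : ℕ) : 0 < complexity w n :=
  (Set.ncard_pos (Set.toFinite _)).2 ⟨fun i => w (0 + i), 0, fun _ => rfl⟩

theorem complexity_add_le {A : Type*} [Finite A] (w : ℕ → A) (m n : ℕ) :
    complexity w (m + n) ≤ complexity w m * complexity w n := by
  unfold complexity
  rw [← Set.ncard_prod]
  refine Set.ncard_le_ncard_of_injOn
    (fun v => (fun i => v (Fin.castAdd n i), fun i => v (Fin.natAdd m i))) ?_ ?_ (Set.toFinite _)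
  · rintro v ⟨k, hk⟩
    refine ⟨⟨k, fun i => by simp [hk]⟩, ⟨k + m, fun i => by simp [hk, add_assoc]⟩⟩
  · intro u _ v _ huv
    simp only [Prod.mk.injEq] at huv
    funext i
    refine Fin.addCases (fun j => congrFun huv.1 j) (fun j => congrFun huv.2 j) i

/-- Over a finite alphabet the limit that defines `entropy` exists. -/
theorem tendsto_entropy {A : Type*} [Finite A] (w : ℕ → A) :
    Tendsto (fun n : ℕ => (1 / (n : ℝ)) * Real.log (complexity w n)) atTop
      (𝓝 (entropy w)) := by
  have hs : Subadditive (fun n : ℕ => Real.log (complexity w n)) := by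
    intro m n
    have hm : (0 : ℝ) < complexity w m := by exact_mod_cast complexity_pos w m
    have hn : (0 : ℝ) < complexity w n := by exact_mod_cast complexity_pos w n
    have hmn : (0 : ℝ) < complexity w (m + n) := by exact_mod_cast complexity_pos w (m + n)
    rw [← Real.log_mul hm.ne' hn.ne']
    exact Real.log_le_log hmn (by exact_mod_cast complexity_add_le w m n)
  have hb : BddBelow (Set.range fun n : ℕ => Real.log (complexity w n) / n) := by
    refine ⟨0, ?_⟩
    rintro _ ⟨n, rfl⟩
    have h1 : (1 : ℝ) ≤ complexity w n := by exact_mod_cast complexity_pos w n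
    have := Real.log_nonneg h1
    positivity
  refine tendsto_nhds_limUnder ⟨hs.lim, ?_⟩
  simpa only [one_div, inv_mul_eq_div] using hs.tendsto_lim hb

end WordComplexity

/-! Put `β = e^h`. The word is a generic point of the `β`-shift, presented by an automaton with
states in `(0, 1]`: from `a`, each digit below `top β a` leads to `1`, and the digit `top β a` leads
to `next β a`. Since `β * a = top β a * 1 + next β a`, the state itself is a weight multiplied by
`β` at each step, so about `β ^ n` words of length `n` are readable from `1`
(`mul_pow_le_card_words`, `card_words_le`). This language is closed under factors, and zeros lead
from any positive state back to `1`; hence all its words can be strung into one infinite word having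
exactly these factors (`exists_word`). For the entropy, a function of exponential order `h` bounds
`E(w)` by `h`, and this word attains the bound. -/

namespace BetaShift

/-- The largest digit that may be read in the state `a` of the `β`-shift automaton. -/
noncomputable def top (β a : ℝ) : ℕ := ⌈β * a⌉₊ - 1

/-- The state reached from `a` by reading the largest digit. -/
noncomputable def next (β a : ℝ) : ℝ := β * a - top β a

variable {β : ℝ}

theorem top_lt {a : ℝ} (hβ : 1 < β) (ha : 0 < a) : (top β a : ℝ) < β * a := by
  have hp : 0 < β * a := by positivity
  have h1 : 0 < ⌈β * a⌉₊ := Nat.ceil_pos.2 hp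
  exact Nat.lt_ceil.1 (show top β a < _ by unfold top; omega)

theorem le_top_add_one (a : ℝ) : β * a ≤ top β a + 1 := by
  have h : ⌈β * a⌉₊ ≤ top β a + 1 := by unfold top; omega
  exact_mod_cast Nat.ceil_le.1 h

/-- Rounding by `⌈β * a⌉₊ - 1` instead of the floor excludes the state `0`, from which there would
be no return to `1`. -/
theorem next_pos {a : ℝ} (hβ : 1 < β) (ha : 0 < a) : 0 < next β a :=
  sub_pos.2 (top_lt hβ ha)

theorem next_le_one (a : ℝ) : next β a ≤ 1 := by
  have := le_top_add_one (β := β) a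
  unfold next
  linarith

theorem top_mono {a b : ℝ} (hβ : 1 < β) (hab : a ≤ b) : top β a ≤ top β b := by
  have : ⌈β * a⌉₊ ≤ ⌈β * b⌉₊ := Nat.ceil_mono (by gcongr)
  unfold top
  omega

/-! ### Admissible words and their number -/

/-- The words of length `n` that can be read from the state `a`. -/
noncomputable def words (β : ℝ) : ℕ → ℝ → Finset (List ℕ)
  | 0, _ => {[]}
  | n + 1, a =>
    (Finset.range (top β a) ×ˢ words β n 1).image (fun p => p.1 :: p.2) ∪
      (words β n (next β a)).image (fun l => top β a :: l)

theorem mem_words_zero {a : ℝ} {l : List ℕ} : l ∈ words β 0 a ↔ l = [] := by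
  simp [words]

theorem cons_mem_words {n d : ℕ} {a : ℝ} {l : List ℕ} :
    d :: l ∈ words β (n + 1) a ↔
      (d < top β a ∧ l ∈ words β n 1) ∨ (d = top β a ∧ l ∈ words β n (next β a)) := by
  simp only [words, Finset.mem_union, Finset.mem_image, Finset.mem_product, Finset.mem_range,
    Prod.exists, List.cons.injEq]
  constructor
  · rintro (⟨x, y, h, rfl, rfl⟩ | ⟨x, h, rfl, rfl⟩)
    · exact Or.inl h
    · exact Or.inr ⟨rfl, h⟩
  · rintro (h | ⟨rfl, h⟩)
    · exact Or.inl ⟨d, l, h, rfl, rfl⟩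
    · exact Or.inr ⟨l, h, rfl, rfl⟩

theorem nil_notMem_words_succ {n : ℕ} {a : ℝ} : [] ∉ words β (n + 1) a := by
  simp [words]

theorem length_of_mem_words {n : ℕ} {a : ℝ} {l : List ℕ} (h : l ∈ words β n a) :
    l.length = n := by
  induction n generalizing a l with
  | zero => simp [mem_words_zero.1 h]
  | succ n ih =>
    cases l with
    | nil => exact absurd h nil_notMem_words_succ
    | cons d l =>
      rcases cons_mem_words.1 h with h | h <;> simp [ih h.2]

/-- If the top digits differ, that of `a` leads from `b` to state `1`, which dominates `next β a`;
if they agree, the next states keep their order. -/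
theorem words_mono (hβ : 1 < β) {n : ℕ} {a b : ℝ} (hab : a ≤ b) :
    words β n a ⊆ words β n b := by
  induction n generalizing a b with
  | zero => simp [words]
  | succ n ih =>
    intro l hl
    cases l with
    | nil => exact absurd hl nil_notMem_words_succ
    | cons d l =>
      have ht := top_mono hβ hab
      rw [cons_mem_words] at hl ⊢
      rcases hl with ⟨hd, hl⟩ | ⟨hd, hl⟩
      · exact Or.inl ⟨hd.trans_le ht, hl⟩
      · rcases ht.lt_or_eq with ht | ht
        · exact Or.inl ⟨hd ▸ ht, ih (next_le_one a) hl⟩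
        · refine Or.inr ⟨hd.trans ht, ih ?_ hl⟩
          have : β * a ≤ β * b := by gcongr
          simp only [next, ht]
          linarith

theorem card_words_succ (n : ℕ) (a : ℝ) :
    (words β (n + 1) a).card =
      top β a * (words β n 1).card + (words β n (next β a)).card := by
  rw [words, Finset.card_union_of_disjoint, Finset.card_image_of_injective,
    Finset.card_image_of_injective, Finset.card_product, Finset.card_range]
  · exact fun _ _ h => (List.cons.inj h).2
  · exact fun _ _ h => Prod.ext (List.cons.inj h).1 (List.cons.inj h).2
  · rw [Finset.disjoint_left]
    intro l h1 h2
    simp only [Finset.mem_image, Finset.mem_product, Finset.mem_range] at h1 h2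
    obtain ⟨p, ⟨hp, -⟩, rfl⟩ := h1
    obtain ⟨l', -, h⟩ := h2
    exact hp.ne' (List.cons.inj h).1

theorem mul_pow_le_card_words (hβ : 1 < β) (n : ℕ) {a : ℝ} (ha : 0 < a) (ha1 : a ≤ 1) :
    a * β ^ n ≤ (words β n a).card := by
  induction n generalizing a with
  | zero => simpa [words] using ha1
  | succ n ih =>
    have h1 := ih one_pos le_rfl
    have h2 := ih (next_pos hβ ha) (next_le_one a)
    have h3 : (top β a : ℝ) * (1 * β ^ n) ≤ top β a * (words β n 1).card := by gcongr
    rw [card_words_succ]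
    push_cast
    calc a * β ^ (n + 1) = top β a * (1 * β ^ n) + next β a * β ^ n := by
          unfold next; ring
      _ ≤ _ := by linarith

/-- The excess over the weight is at most `β * a` per step, by `top_lt`; these excesses sum to a
geometric series. -/
theorem card_words_le (hβ : 1 < β) (n : ℕ) {a : ℝ} (ha : 0 < a) :
    ((words β n a).card : ℝ) ≤ 1 + a * (β / (β - 1) * (β ^ n - 1)) := by
  have hβ' : β - 1 ≠ 0 := by linarith
  induction n generalizing a with
  | zero => simp [words]
  | succ n ih =>
    have h1 := ih one_pos
    have h2 := ih (next_pos hβ ha)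
    have h3 : (top β a : ℝ) * (words β n 1).card ≤
      top β a * (1 + 1 * (β / (β - 1) * (β ^ n - 1))) := by gcongr
    have h4 := top_lt hβ ha
    rw [card_words_succ]
    push_cast
    calc _ ≤ top β a * (1 + 1 * (β / (β - 1) * (β ^ n - 1))) +
          (1 + next β a * (β / (β - 1) * (β ^ n - 1))) := add_le_add h3 h2
      _ = 1 + top β a + β * a * (β / (β - 1) * (β ^ n - 1)) := by unfold next; ring
      _ ≤ 1 + β * a + β * a * (β / (β - 1) * (β ^ n - 1)) := by linarith
      _ = 1 + a * (β / (β - 1) * (β ^ (n + 1) - 1)) := by field_simp; ring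

theorem card_words_one_le (hβ : 1 < β) (n : ℕ) :
    ((words β n 1).card : ℝ) ≤ β / (β - 1) * β ^ n := by
  have h := card_words_le hβ n one_pos
  have h1 : 1 ≤ β / (β - 1) := by
    rw [le_div_iff₀ (by linarith)]
    linarith
  linarith

/-! ### Runs and closure under factors -/

/-- `Run β a l b`: reading the word `l` leads from the state `a` to the state `b`. -/
inductive Run (β : ℝ) : ℝ → List ℕ → ℝ → Prop
  | nil (a : ℝ) : Run β a [] a
  | full {a b : ℝ} {d : ℕ} {l : List ℕ} (hd : d < top β a) (h : Run β 1 l b) : Run β a (d :: l) b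
  | last {a b : ℝ} {l : List ℕ} (h : Run β (next β a) l b) : Run β a (top β a :: l) b

theorem Run.append {a b c : ℝ} {l m : List ℕ} (h : Run β a l b) (h' : Run β b m c) :
    Run β a (l ++ m) c := by
  induction h with
  | nil => exact h'
  | full hd _ ih => exact .full hd (ih h')
  | last _ ih => exact .last (ih h')

theorem Run.pos (hβ : 1 < β) {a b : ℝ} {l : List ℕ} (h : Run β a l b) (ha : 0 < a) : 0 < b := by
  induction h with
  | nil => exact ha
  | full _ _ ih => exact ih one_pos
  | last _ ih => exact ih (next_pos hβ ha)

theorem Run.mem_words {a b : ℝ} {l : List ℕ} (h : Run β a l b) : l ∈ words β l.length a := by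
  induction h with
  | nil => exact mem_words_zero.2 rfl
  | full hd _ ih => exact cons_mem_words.2 (Or.inl ⟨hd, ih⟩)
  | last _ ih => exact cons_mem_words.2 (Or.inr ⟨rfl, ih⟩)

theorem exists_run {n : ℕ} {a : ℝ} {l : List ℕ} (h : l ∈ words β n a) : ∃ b, Run β a l b := by
  induction n generalizing a l with
  | zero =>
    obtain rfl := mem_words_zero.1 h
    exact ⟨a, .nil a⟩
  | succ n ih =>
    cases l with
    | nil => exact absurd h nil_notMem_words_succ
    | cons d l =>
      rcases cons_mem_words.1 h with ⟨hd, h'⟩ | ⟨rfl, h'⟩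
      · exact (ih h').imp fun _ => .full hd
      · exact (ih h').imp fun _ => .last

theorem take_mem_words {n : ℕ} {a : ℝ} {l : List ℕ} (h : l ∈ words β n a) (k : ℕ) :
    l.take k ∈ words β (l.take k).length a := by
  induction n generalizing a l k with
  | zero =>
    obtain rfl := mem_words_zero.1 h
    simp [words]
  | succ n ih =>
    cases l with
    | nil => exact absurd h nil_notMem_words_succ
    | cons d l =>
      cases k with
      | zero => simp [words]
      | succ k =>
        rw [List.take_succ_cons, List.length_cons, cons_mem_words]
        exact (cons_mem_words.1 h).imp (And.imp_right fun h => ih h k)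
          (And.imp_right fun h => ih h k)

theorem drop_mem_words (hβ : 1 < β) {n : ℕ} {l : List ℕ} (h : l ∈ words β n 1) (k : ℕ) :
    l.drop k ∈ words β (l.drop k).length 1 := by
  induction k generalizing n l with
  | zero => simpa [length_of_mem_words h] using h
  | succ k ih =>
    cases l with
    | nil => simp [words]
    | cons d l =>
      cases n with
      | zero => exact absurd (mem_words_zero.1 h) (List.cons_ne_nil _ _)
      | succ n =>
        rw [List.drop_succ_cons]
        rcases cons_mem_words.1 h with h | h
        · exact ih h.2
        · exact ih (words_mono hβ (next_le_one _) h.2)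

theorem lt_ceil_of_mem_words (hβ : 1 < β) {n : ℕ} {l : List ℕ} (h : l ∈ words β n 1) {d : ℕ}
    (hd : d ∈ l) : d < ⌈β⌉₊ := by
  have h0 : 0 < ⌈β⌉₊ := Nat.ceil_pos.2 (by linarith)
  induction n generalizing l with
  | zero =>
    obtain rfl := mem_words_zero.1 h
    simp at hd
  | succ n ih =>
    cases l with
    | nil => simp at hd
    | cons e l =>
      have he : e ≤ top β 1 := by
        rcases cons_mem_words.1 h with h | h
        · exact h.1.le
        · exact h.1.le
      have hl : l ∈ words β n 1 := by
        rcases cons_mem_words.1 h with h | h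
        · exact h.2
        · exact words_mono hβ (next_le_one _) h.2
      rcases List.mem_cons.1 hd with rfl | hd
      · simp only [top, mul_one] at he
        omega
      · exact ih hl hd

theorem top_one_pos (hβ : 1 < β) : 0 < top β 1 := by
  have : 1 < ⌈β * 1⌉₊ := Nat.lt_ceil.2 (by simpa using hβ)
  unfold top
  omega

/-- While `top β a = 0`, reading `0` multiplies the state by `β`; once the top digit is positive,
`0` lies below it and leads to `1`. -/
theorem exists_run_replicate_zero (hβ : 1 < β) {a : ℝ} (ha : 0 < a) :
    ∃ m, Run β a (List.replicate (m + 1) 0) 1 := by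
  obtain ⟨k, hk⟩ := pow_unbounded_of_one_lt (1 / a) hβ
  rw [div_lt_iff₀ ha] at hk
  induction k generalizing a with
  | zero =>
    have h := top_mono hβ (show 1 ≤ a by linarith)
    exact ⟨0, .full ((top_one_pos hβ).trans_le h) (.nil 1)⟩
  | succ k ih =>
    rcases Nat.eq_zero_or_pos (top β a) with h | h
    · have hn : next β a = β * a := by simp [next, h]
      obtain ⟨m, hm⟩ := ih (next_pos hβ ha) (by rw [hn]; linarith [pow_succ β k,
        show β ^ k * (β * a) = β ^ (k + 1) * a by ring])
      refine ⟨m + 1, ?_⟩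
      have := Run.last hm
      rwa [h] at this
    · exact ⟨0, .full h (.nil 1)⟩

/-! ### The infinite word -/

/-- A sequence of words, each a prefix of the next, in which every admissible word occurs. -/
theorem exists_prefix_chain (hβ : 1 < β) :
    ∃ U : ℕ → List ℕ, (∀ k, U k ∈ words β (U k).length 1) ∧ (∀ k, U k <+: U (k + 1)) ∧
      (∀ k, k ≤ (U k).length) ∧ ∀ n, ∀ l ∈ words β n 1, ∃ k, l <:+: U k := by
  let S := {l : List ℕ // ∃ b, Run β 1 l b}
  have : Nonempty S := ⟨⟨[], 1, .nil 1⟩⟩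
  obtain ⟨e, he⟩ := exists_surjective_nat S
  have step : ∀ (k : ℕ) (u : {l : List ℕ // Run β 1 l 1}), ∃ m : ℕ,
      Run β 1 (u.1 ++ (e k).1 ++ List.replicate (m + 1) 0) 1 := by
    intro k u
    obtain ⟨b, hb⟩ := (e k).2
    obtain ⟨m, hm⟩ := exists_run_replicate_zero hβ (hb.pos hβ one_pos)
    exact ⟨m, (u.2.append hb).append hm⟩
  choose m hm using step
  -- Each stage appends the next admissible word and at least one zero, so the lengths grow even
  -- when that word is empty.
  let V : ℕ → {l : List ℕ // Run β 1 l 1} :=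
    fun k => Nat.rec ⟨[], .nil 1⟩ (fun k u => ⟨_, hm k u⟩) k
  have hV : ∀ k, (V (k + 1)).1 = (V k).1 ++ (e k).1 ++ List.replicate (m k (V k) + 1) 0 :=
    fun _ => rfl
  refine ⟨fun k => (V k).1, fun k => (V k).2.mem_words, fun k => ?_, fun k => ?_,
    fun n l hl => ?_⟩
  · exact ⟨(e k).1 ++ List.replicate (m k (V k) + 1) 0, by
      change _ = (V (k + 1)).1
      rw [hV, List.append_assoc]⟩
  · induction k with
    | zero => exact Nat.zero_le _
    | succ k ih =>
      change k ≤ (V k).1.length at ih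
      simp only [hV, List.length_append, List.length_replicate]
      omega
  · obtain ⟨k, hk⟩ := he ⟨l, exists_run hl⟩
    exact ⟨k + 1, (V k).1, List.replicate (m k (V k) + 1) 0, by
      change _ = (V (k + 1)).1
      rw [hV, hk]⟩

/-- An infinite word whose factors are the admissible words. -/
theorem exists_word (hβ : 1 < β) :
    ∃ w : ℕ → ℕ, (∀ k n, List.ofFn (fun i : Fin n => w (k + i)) ∈ words β n 1) ∧
      ∀ n, ∀ l ∈ words β n 1, ∃ k, List.ofFn (fun i : Fin n => w (k + i)) = l := by
  obtain ⟨U, hU, hpre, hlen, hall⟩ := exists_prefix_chain hβ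
  have hmono : ∀ {i j}, i ≤ j → U i <+: U j := fun {i j} hij =>
    Nat.le_induction (List.prefix_refl _) (fun k _ h => h.trans (hpre k)) j hij
  let w : ℕ → ℕ := fun i => (U (i + 1))[i]'(hlen (i + 1))
  have hw : ∀ k i, ∀ h : i < (U k).length, (U k)[i] = w i := by
    intro k i h
    rcases le_total k (i + 1) with hk | hk
    · exact (hmono hk).getElem h
    · exact ((hmono hk).getElem (hlen (i + 1))).symm
  refine ⟨w, fun k n => ?_, fun n l hl => ?_⟩
  · have hkn := hlen (k + n)
    have h : List.ofFn (fun i : Fin n => w (k + i)) = ((U (k + n)).drop k).take n := by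
      apply List.ext_getElem
      · simp; omega
      · intro i h1 h2
        simp [hw]
    have h1 := take_mem_words (drop_mem_words hβ (hU (k + n)) k) n
    rw [← h, List.length_ofFn] at h1
    exact h1
  · obtain ⟨k, s, t, hst⟩ := hall n l hl
    have hn := length_of_mem_words hl
    refine ⟨s.length, ?_⟩
    apply List.ext_getElem
    · simp [hn]
    · intro i h1 h2
      have h3 : s.length + i < (U k).length := by
        rw [← hst]; simp; omega
      rw [List.getElem_ofFn, ← hw k _ h3]
      simp [← hst, h2]

theorem exists_word_complexity (hβ : 1 < β) {q : ℕ} (hq : ⌈β⌉₊ ≤ q) :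
    ∃ w : ℕ → Fin q, ∀ n, WordComplexity.complexity w n = (words β n 1).card := by
  obtain ⟨w, hw, hall⟩ := exists_word hβ
  have hlt : ∀ i, w i < q := fun i =>
    (lt_ceil_of_mem_words hβ (hw i 1) (by simp)).trans_le hq
  refine ⟨fun i => ⟨w i, hlt i⟩, fun n => ?_⟩
  have hinj : Function.Injective (fun v : Fin n → Fin q => List.ofFn (fun i => (v i : ℕ))) :=
    fun u v h => funext fun i => Fin.ext (congrFun (List.ofFn_injective h) i)
  rw [WordComplexity.complexity, ← Set.ncard_image_of_injective _ hinj, ← Set.ncard_coe_finset]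
  congr 1
  ext l
  constructor
  · rintro ⟨v, ⟨k, hk⟩, rfl⟩
    simpa [hk] using hw k n
  · intro hl
    obtain ⟨k, hk⟩ := hall n l hl
    exact ⟨fun i => ⟨w (k + i), hlt _⟩, ⟨k, fun i => rfl⟩, hk⟩

end BetaShift

/-! ### Exponential order, growth rate and word entropy -/

namespace WordComplexity

theorem HasExponentialOrder.tendsto {f : ℕ → ℝ} {h : ℝ} (hf : HasExponentialOrder f h) :
    Tendsto (fun n : ℕ => (1 / (n : ℝ)) * Real.log (f n)) atTop (𝓝 h) := by
  obtain ⟨c₁, c₂, h₁, h₂, hc⟩ := hf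
  have key : ∀ c : ℝ, Tendsto (fun n : ℕ => (1 / (n : ℝ)) * Real.log c + h) atTop (𝓝 h) := by
    intro c
    simpa using (tendsto_one_div_atTop_nhds_zero_nat.mul_const (Real.log c)).add_const h
  have hlog : ∀ c : ℝ, 0 < c → ∀ n : ℕ, 0 < n →
      (1 / (n : ℝ)) * Real.log (c * Real.exp (h * n)) = (1 / (n : ℝ)) * Real.log c + h := by
    intro c hc n hn
    rw [Real.log_mul hc.ne' (Real.exp_pos _).ne', Real.log_exp]
    field_simp
  refine tendsto_of_tendsto_of_tendsto_of_le_of_le' (key c₁) (key c₂) ?_ ?_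
  · filter_upwards [eventually_gt_atTop 0] with n hn
    rw [← hlog c₁ h₁ n hn]
    have : 0 < c₁ * Real.exp (h * n) := by positivity
    exact mul_le_mul_of_nonneg_left (Real.log_le_log this (hc n).1) (by positivity)
  · filter_upwards [eventually_gt_atTop 0] with n hn
    rw [← hlog c₂ h₂ n hn]
    have : 0 < c₁ * Real.exp (h * n) := by positivity
    exact mul_le_mul_of_nonneg_left (Real.log_le_log (this.trans_le (hc n).1) (hc n).2)
      (by positivity)

theorem conditionsCStar_maxLinearExp {c h : ℝ} (hc : 1 ≤ c) (hh : 0 < h) :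
    ConditionsCStar (maxLinearExp c h) := by
  refine ⟨fun n => ⟨max_lt_max ?_ ?_, le_max_left _ _⟩, fun m n => max_le ?_ ?_⟩
  · push_cast
    linarith
  · gcongr
    simp
  · calc ((m + n : ℕ) : ℝ) + 1 ≤ ((m : ℝ) + 1) * ((n : ℝ) + 1) := by
          push_cast
          nlinarith [mul_nonneg (Nat.cast_nonneg (α := ℝ) m) (Nat.cast_nonneg (α := ℝ) n)]
      _ ≤ _ := by
          unfold maxLinearExp
          gcongr <;> exact le_max_left _ _
  · calc c * Real.exp (h * ((m + n : ℕ) : ℝ))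
          = 1 * (c * (Real.exp (h * m) * Real.exp (h * n))) := by
          rw [← Real.exp_add]
          push_cast
          ring_nf
      _ ≤ c * (c * (Real.exp (h * m) * Real.exp (h * n))) := by gcongr
      _ = c * Real.exp (h * m) * (c * Real.exp (h * n)) := by ring
      _ ≤ _ := by
          unfold maxLinearExp
          gcongr <;> exact le_max_right _ _

theorem hasExponentialOrder_maxLinearExp {c h : ℝ} (hc : 1 ≤ c) (hh : 0 < h) :
    HasExponentialOrder (maxLinearExp c h) h := by
  refine ⟨c, c + 1 + 1 / h, by positivity, by positivity, fun n => ⟨le_max_right _ _, ?_⟩⟩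
  have h1 : 1 ≤ Real.exp (h * n) := Real.one_le_exp (by positivity)
  have h2 : h * n ≤ Real.exp (h * n) := by linarith [Real.add_one_le_exp (h * n)]
  refine max_le ?_ ?_
  · calc (n : ℝ) + 1 = 1 / h * (h * n) + 1 := by field_simp
      _ ≤ 1 / h * Real.exp (h * n) + Real.exp (h * n) := by gcongr
      _ ≤ (c + 1 + 1 / h) * Real.exp (h * n) := by nlinarith
  · have : 0 < 1 / h := by positivity
    gcongr
    linarith

theorem HasExponentialOrder.lowerGrowth_eq {f : ℕ → ℝ} {h : ℝ} (hf : HasExponentialOrder f h) :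
    lowerGrowth f = (h : EReal) :=
  (EReal.tendsto_coe.2 hf.tendsto).liminf_eq

theorem HasExponentialOrder.entropy_eq {A : Type*} [Finite A] {w : ℕ → A} {h : ℝ}
    (hw : HasExponentialOrder (fun n => (complexity w n : ℝ)) h) : entropy w = h :=
  tendsto_nhds_unique (tendsto_entropy w) hw.tendsto

theorem HasExponentialOrder.wordEntropy_le {f : ℕ → ℝ} {h : ℝ} (hf : HasExponentialOrder f h)
    (q : ℕ) : wordEntropy q f ≤ (h : EReal) := by
  refine iSup₂_le fun w hw => EReal.coe_le_coe_iff.2 ?_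
  refine le_of_tendsto_of_tendsto' (tendsto_entropy w) hf.tendsto fun n => ?_
  have : (0 : ℝ) < complexity w n := by exact_mod_cast complexity_pos w n
  exact mul_le_mul_of_nonneg_left (Real.log_le_log this (hw n)) (by positivity)

end WordComplexity

theorem corollary8p3 :
    ∃ C : ℝ → ℝ, AntitoneOn C (Set.Ioi 0) ∧
      ∀ h : ℝ, 0 < h →
        1 ≤ C h ∧
        WordComplexity.ConditionsCStar (WordComplexity.maxLinearExp (C h) h) ∧
        WordComplexity.HasExponentialOrder (WordComplexity.maxLinearExp (C h) h) h ∧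
        WordComplexity.lowerGrowth (WordComplexity.maxLinearExp (C h) h) = (h : EReal) ∧
        ∀ q : ℕ, ⌈Real.exp h⌉₊ ≤ q →
          (∃ w : ℕ → Fin q, ∀ n : ℕ,
            Real.exp (h * n) ≤ (WordComplexity.complexity w n : ℝ) ∧
              (WordComplexity.complexity w n : ℝ) ≤ C h * Real.exp (h * n)) ∧
          WordComplexity.wordEntropy q (WordComplexity.maxLinearExp (C h) h) = (h : EReal) := by
  -- This is the constant `β / (β - 1)` of `card_words_one_le`.
  refine ⟨fun h => Real.exp h / (Real.exp h - 1), ?_, fun h hh => ?_⟩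
  · intro a ha b hb hab
    have ha1 : 1 < Real.exp a := Real.one_lt_exp_iff.2 ha
    have hab' : Real.exp a ≤ Real.exp b := Real.exp_le_exp.2 hab
    change Real.exp b / (Real.exp b - 1) ≤ Real.exp a / (Real.exp a - 1)
    rw [div_le_div_iff₀ (by linarith) (by linarith)]
    linarith [mul_comm (Real.exp a) (Real.exp b)]
  · have hβ : 1 < Real.exp h := Real.one_lt_exp_iff.2 hh
    have hC : 1 ≤ Real.exp h / (Real.exp h - 1) := by
      rw [le_div_iff₀ (by linarith)]
      linarith
    have hf := WordComplexity.hasExponentialOrder_maxLinearExp hC hh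
    refine ⟨hC, WordComplexity.conditionsCStar_maxLinearExp hC hh, hf, hf.lowerGrowth_eq,
      fun q hq => ?_⟩
    obtain ⟨w, hw⟩ := BetaShift.exists_word_complexity hβ hq
    have hexp : ∀ n : ℕ, Real.exp (h * n) = Real.exp h ^ n := fun n => by
      rw [mul_comm, Real.exp_nat_mul]
    have hbounds : ∀ n : ℕ, Real.exp (h * n) ≤ (WordComplexity.complexity w n : ℝ) ∧
        (WordComplexity.complexity w n : ℝ) ≤
          Real.exp h / (Real.exp h - 1) * Real.exp (h * n) := by
      intro n
      rw [hw, hexp]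
      exact ⟨by simpa using BetaShift.mul_pow_le_card_words hβ n one_pos le_rfl,
        BetaShift.card_words_one_le hβ n⟩
    refine ⟨⟨w, hbounds⟩, le_antisymm (hf.wordEntropy_le q) ?_⟩
    have hE : WordComplexity.entropy w = h := WordComplexity.HasExponentialOrder.entropy_eq
      ⟨1, _, one_pos, by positivity, fun n => ⟨by simpa using (hbounds n).1, (hbounds n).2⟩⟩
    rw [← hE]
    refine le_iSup₂_of_le w (fun n => (hbounds n).2.trans ?_) le_rfl
    rw [hE]
    exact le_max_right _ _
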